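/- All topological groups are Hausdorff. A topological group $G$ is *minimal* if every Hausdorff group topology on $G$ that is coarser than or equal to the given one coincides with it. For a topological space $X$, let $w(X)$ be its weight (least cardinality of a base), $\chi(X)$ its character (the supremum over $x \in X$ of the least cardinality of a neighbourhood base at $x$), and $t(X)$ its tightness (the least cardinal $\tau$ such that whenever $x\in\overline{A}$, $A\subseteq X$, there is $B\subseteq A$ with $|B|\le\tau$ and $x\in\overline{B}$); all three are taken to be at least $\aleph_0$. Let $\mathbb T=\mathbb R/\mathbb Z$ and $\mathfrak c=2^{\aleph_0}$. Let $\kappa$ be an uncountable cardinal. The Heisenberg group $\mathcal H(\mathbb T^\kappa)$ is the set $\mathbb T\times\mathbb T^\kappa\times\mathbb Z^{(\kappa)}$, where $\mathbb Z^{(\kappa)}=\bigoplus_\kappa\mathbb Z$ is the discrete character group of $\mathbb T^\kappa$ acting by $f(x)=\sum_{i<\kappa} f_i x_i$, with the product topology and the multiplication $$(a_1,x_1,f_1)\cdot(a_2,x_2,f_2)=(a_1+a_2+f_1(x_2),\,x_1+x_2,\,f_1+f_2).$$ For a subgroup $H$ of $\mathbb T^\kappa$ let $G_H=\mathbb T\times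 H\times\mathbb Z^{(\kappa)}$, a subgroup of $\mathcal H(\mathbb T^\kappa)$, with the subspace topology. **Theorem.** Let $\kappa$ be an uncountable cardinal and let $H$ be a dense subgroup of $\mathbb T^\kappa$. Then $G_H$ is a minimal topological group, it is nilpotent of nilpotency class exactly $2$, and it has an open subgroup of index $\kappa$ that is topologically isomorphic to $H\times\mathbb T$. Moreover, $$|G_H|=\mathfrak c\cdot\kappa\cdot|H|,\qquad t(G_H)=t(H\times\mathbb T),\qquad w(G_H)=\chi(G_H)=\chi(H)=\kappa.$$ -/

import Mathlib

open Cardinal Topology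

universe u

/-! ### Cardinal invariants (always taking infinite values) -/

/-- Tightness `t(X)`: the least infinite cardinal `τ` such that every point in the closure of a set
`A` lies in the closure of a subset of `A` of cardinality at most `τ`. -/
noncomputable def tightness (X : Type u) [TopologicalSpace X] : Cardinal.{u} :=
  sInf {τ | ℵ₀ ≤ τ ∧ ∀ (A : Set X) (x : X), x ∈ closure A →
    ∃ B : Set X, B ⊆ A ∧ #B ≤ τ ∧ x ∈ closure B}

/-- The least cardinality of a neighbourhood base at `x`. -/
noncomputable def characterAt {X : Type u} [TopologicalSpace X] (x : X) : Cardinal.{u} :=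
  sInf {c | ∃ B : Set (Set X), (𝓝 x).HasBasis (fun s : Set X => s ∈ B) id ∧ #B = c}

/-- Character `χ(X)`. -/
noncomputable def character (X : Type u) [TopologicalSpace X] : Cardinal.{u} :=
  max ℵ₀ (⨆ x : X, characterAt x)

/-- Weight `w(X)`. -/
noncomputable def weight (X : Type u) [TopologicalSpace X] : Cardinal.{u} :=
  max ℵ₀ (sInf {c | ∃ B : Set (Set X), TopologicalSpace.IsTopologicalBasis B ∧ #B = c})

/-! ### Minimal topological groups -/

/-- A group with a topology is minimal if the topology is a Hausdorff group topology and no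
Hausdorff group topology on the group is strictly coarser.
(In Mathlib's order, `t ≤ t'` says that every `t'`-open set is `t`-open.) -/
structure IsMinimalGroup (G : Type*) [Group G] [t : TopologicalSpace G] : Prop where
  isTopologicalGroup : IsTopologicalGroup G
  t2Space : T2Space G
  eq_of_coarser : ∀ t' : TopologicalSpace G,
    @IsTopologicalGroup G t' _ → @T2Space G t' → t ≤ t' → t' = t

/-! ### The Heisenberg group of `𝕋^ι` -/

/-- The underlying set `𝕋 × 𝕋^ι × ℤ^(ι)`, where `𝕋 = ℝ/ℤ` and `ℤ^(ι)` is the direct sum of `ι`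
copies of `ℤ`, that is, the character group of `𝕋^ι`. -/
@[ext]
structure Heisenberg (ι : Type u) : Type u where
  a : UnitAddCircle
  x : ι → UnitAddCircle
  f : ι →₀ ℤ

namespace Heisenberg

variable {ι : Type u}

/-- The value `f(x) = ∑ i, f i • x i` of the character `f ∈ ℤ^(ι)` at `x ∈ 𝕋^ι`. -/
noncomputable def pairing (f : ι →₀ ℤ) (x : ι → UnitAddCircle) : UnitAddCircle :=
  f.sum fun i n => n • x i

theorem pairing_zero_left (x : ι → UnitAddCircle) : pairing 0 x = 0 :=
  Finsupp.sum_zero_index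

theorem pairing_add_left (f g : ι →₀ ℤ) (x : ι → UnitAddCircle) :
    pairing (f + g) x = pairing f x + pairing g x :=
  Finsupp.sum_add_index' (fun _ => zero_smul _ _) (fun _ _ _ => add_smul _ _ _)

theorem pairing_add_right (f : ι →₀ ℤ) (x y : ι → UnitAddCircle) :
    pairing f (x + y) = pairing f x + pairing f y := by
  simp [pairing, Finsupp.sum, smul_add, Finset.sum_add_distrib]

theorem pairing_neg_left (f : ι →₀ ℤ) (x : ι → UnitAddCircle) :
    pairing (-f) x = -pairing f x :=
  eq_neg_of_add_eq_zero_left (by rw [← pairing_add_left, neg_add_cancel, pairing_zero_left])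

noncomputable instance : Mul (Heisenberg ι) :=
  ⟨fun u v => ⟨u.a + v.a + pairing u.f v.x, u.x + v.x, u.f + v.f⟩⟩

noncomputable instance : One (Heisenberg ι) := ⟨⟨0, 0, 0⟩⟩

noncomputable instance : Inv (Heisenberg ι) :=
  ⟨fun u => ⟨-u.a + pairing u.f u.x, -u.x, -u.f⟩⟩

theorem mul_def (u v : Heisenberg ι) :
    u * v = ⟨u.a + v.a + pairing u.f v.x, u.x + v.x, u.f + v.f⟩ := rfl

theorem one_def : (1 : Heisenberg ι) = ⟨0, 0, 0⟩ := rfl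

theorem inv_def (u : Heisenberg ι) :
    u⁻¹ = ⟨-u.a + pairing u.f u.x, -u.x, -u.f⟩ := rfl

noncomputable instance : Group (Heisenberg ι) :=
  Group.ofLeftAxioms
    (fun u v w => by
      simp only [mul_def, pairing_add_left, pairing_add_right, add_assoc, mk.injEq, and_true]
      abel)
    (fun u => by simp [mul_def, one_def, pairing_zero_left])
    (fun u => by simp [mul_def, one_def, inv_def, pairing_neg_left])

/-- The product topology, where `𝕋` has its usual topology, `𝕋^ι` the product topology, and
`ℤ^(ι)` the discrete topology. -/
instance : TopologicalSpace (Heisenberg ι) :=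
  letI : TopologicalSpace (ι →₀ ℤ) := ⊥
  TopologicalSpace.induced
    (fun u : Heisenberg ι => ((u.a, u.x, u.f) : UnitAddCircle × (ι → UnitAddCircle) × (ι →₀ ℤ)))
    inferInstance

/-- The subgroup `G_H = 𝕋 × H × ℤ^(ι)` of the Heisenberg group, with the subspace topology. -/
noncomputable def subgroupOver (H : AddSubgroup (ι → UnitAddCircle)) :
    Subgroup (Heisenberg ι) where
  carrier := {u | u.x ∈ H}
  mul_mem' hu hv := H.add_mem hu hv
  one_mem' := H.zero_mem
  inv_mem' hu := H.neg_mem hu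

end Heisenberg

/-! Minimality: let `K` be `G_H` with a coarser Hausdorff group topology. The central circle is
compact, so it keeps its topology in `K`. The commutator of `(a,x,f)` and `(b,y,g)` is the central
element `f(y) - g(x)`, hence this pairing is continuous on `K × K` (`continuous_commutatorPairing`).
Pairing with unit characters shows that `x` is continuous on `K`. Near `1` the characters `f` are
uniformly small on a neighbourhood of `0` in `H`, which leaves finitely many of them
(`finite_of_norm_pairing_le`); evaluation at points of `H` excludes the nonzero ones. So `f = 0`
near `1`, and dividing by `(0,x,0)` recovers `a`.

Invariants: `f = 0` defines an open subgroup isomorphic to `H × 𝕋`, whose translates cover `G_H`,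
and tightness is local. The weight is at most `κ` because `κ` circle-valued maps induce the
topology. Conversely, a neighbourhood of `0` in `H` controls only finitely many coordinates, so a
base there needs `κ` members (`mk_le_characterAt_zero`). -/

/-! ### Cardinal invariants -/

section CardinalInvariants

variable {X Y : Type u} [TopologicalSpace X] [TopologicalSpace Y]

theorem exists_hasBasis_mk_eq_characterAt (x : X) :
    ∃ B : Set (Set X), (𝓝 x).HasBasis (fun s : Set X => s ∈ B) id ∧ #B = characterAt x :=
  csInf_mem (s := {c | ∃ B : Set (Set X), (𝓝 x).HasBasis (fun s : Set X => s ∈ B) id ∧ #B = c})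
    ⟨_, {s | s ∈ 𝓝 x}, (𝓝 x).basis_sets, rfl⟩

theorem characterAt_le_mk {x : X} {B : Set (Set X)}
    (h : (𝓝 x).HasBasis (fun s : Set X => s ∈ B) id) : characterAt x ≤ #B :=
  csInf_le' ⟨B, h, rfl⟩

theorem Topology.IsInducing.characterAt_le {f : X → Y} (hf : IsInducing f) (x : X) :
    characterAt x ≤ characterAt (f x) := by
  obtain ⟨B, hB, hcard⟩ := exists_hasBasis_mk_eq_characterAt (f x)
  rw [← hcard]
  refine (characterAt_le_mk (B := (f ⁻¹' ·) '' B) ?_).trans mk_image_le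
  rw [hf.nhds_eq_comap]
  refine ⟨fun t => ?_⟩
  rw [(hB.comap f).mem_iff]
  simp

theorem characterAt_le_character (x : X) : characterAt x ≤ character X :=
  (le_ciSup (f := fun x : X => characterAt x) bddAbove_of_small x).trans (le_max_right _ _)

theorem characterAt_le_weight (x : X) : characterAt x ≤ weight X := by
  refine le_max_of_le_right (le_csInf ?_ ?_)
  · exact ⟨_, _, TopologicalSpace.isTopologicalBasis_opens, rfl⟩
  · rintro _ ⟨B, hB, rfl⟩
    refine (characterAt_le_mk (B := {s ∈ B | x ∈ s}) ?_).trans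
      (mk_le_mk_of_subset fun s hs => hs.1)
    exact hB.nhds_hasBasis

theorem character_le_weight : character X ≤ weight X :=
  max_le (le_max_left _ _) (ciSup_le' characterAt_le_weight)

theorem weight_le_of_eq_generateFrom {S : Set (Set X)}
    (hS : ‹TopologicalSpace X› = TopologicalSpace.generateFrom S) {c : Cardinal.{u}} (hc : ℵ₀ ≤ c)
    (hSc : #S ≤ c) : weight X ≤ c := by
  refine max_le hc (le_trans (csInf_le'
    ⟨_, TopologicalSpace.isTopologicalBasis_of_subbasis hS, rfl⟩) ?_)
  have hsub : (fun f => ⋂₀ f) '' {f : Set (Set X) | f.Finite ∧ f ⊆ S} ⊆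
      Set.range fun F : Finset S => ⋂₀ (Subtype.val '' (F : Set S)) := by
    rintro _ ⟨f, ⟨hf, hfS⟩, rfl⟩
    refine ⟨(hf.preimage Subtype.val_injective.injOn).toFinset, ?_⟩
    simp only [Set.Finite.coe_toFinset, Subtype.image_preimage_coe]
    rw [Set.inter_eq_right.2 hfS]
  refine (mk_le_mk_of_subset hsub).trans (mk_range_le.trans ?_)
  rcases finite_or_infinite S with h | h
  · exact (lt_aleph0_of_finite (Finset S)).le.trans hc
  · exact (mk_finset_of_infinite S).trans_le hSc

/-- Weight of a topology induced by a family of maps to a second countable space. -/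
theorem weight_le_of_eq_iInf_induced {J : Type u} {Z : Type*} [TopologicalSpace Z]
    [SecondCountableTopology Z] (g : J → X → Z)
    (h : ‹TopologicalSpace X› = ⨅ j, TopologicalSpace.induced (g j) inferInstance)
    {c : Cardinal.{u}} (hc : ℵ₀ ≤ c) (hJ : #J ≤ c) : weight X ≤ c := by
  obtain ⟨b, hbc, -, hb⟩ := TopologicalSpace.exists_countable_basis Z
  refine weight_le_of_eq_generateFrom (S := ⋃ j, (g j ⁻¹' ·) '' b) ?_ hc ?_
  · rw [h, generateFrom_iUnion]
    refine iInf_congr fun j => ?_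
    rw [hb.eq_generateFrom, induced_generateFrom_eq]
  · refine (mk_iUnion_le _).trans (mul_le_of_le hc hJ (ciSup_le' fun j => ?_))
    exact ((hbc.image _).le_aleph0).trans hc

/-- Closure points of subsets of `X` are closure points of subsets of cardinality `≤ τ`. -/
def IsTightWith (X : Type u) [TopologicalSpace X] (τ : Cardinal.{u}) : Prop :=
  ∀ (A : Set X) (x : X), x ∈ closure A → ∃ B : Set X, B ⊆ A ∧ #B ≤ τ ∧ x ∈ closure B

theorem Topology.IsEmbedding.isTightWith {f : X → Y} (hf : IsEmbedding f) {τ : Cardinal.{u}}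
    (h : IsTightWith Y τ) : IsTightWith X τ := by
  intro A x hx
  rw [hf.closure_eq_preimage_closure_image] at hx
  obtain ⟨B, hBA, hB, hxB⟩ := h _ _ hx
  refine ⟨f ⁻¹' B, ?_, (mk_preimage_of_injective _ _ hf.injective).trans hB, ?_⟩
  · intro y hy
    obtain ⟨z, hz, hzy⟩ := hBA hy
    rwa [← hf.injective hzy]
  · rw [hf.closure_eq_preimage_closure_image,
      Set.image_preimage_eq_of_subset (hBA.trans (Set.image_subset_range _ _))]
    exact hxB

/-- Tightness is local: closures commute with preimages under open continuous maps, so the small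
subset can be found inside one open copy of `X`. -/
theorem isTightWith_of_isOpenEmbedding
    (hcov : ∀ y : Y, ∃ f : X → Y, IsOpenEmbedding f ∧ y ∈ Set.range f) {τ : Cardinal.{u}}
    (h : IsTightWith X τ) : IsTightWith Y τ := by
  intro A y hy
  obtain ⟨f, hf, x, rfl⟩ := hcov y
  have hx : x ∈ closure (f ⁻¹' A) := by
    rw [← hf.isOpenMap.preimage_closure_eq_closure_preimage hf.continuous]
    exact hy
  obtain ⟨B, hBA, hB, hxB⟩ := h _ _ hx
  exact ⟨f '' B, Set.image_subset_iff.2 hBA, mk_image_le.trans hB,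
    image_closure_subset_closure_image hf.continuous ⟨x, hxB, rfl⟩⟩

theorem tightness_eq_of_isOpenEmbedding [Nonempty Y]
    (hcov : ∀ y : Y, ∃ f : X → Y, IsOpenEmbedding f ∧ y ∈ Set.range f) :
    tightness Y = tightness X := by
  obtain ⟨f, hf, -⟩ := hcov (Classical.arbitrary Y)
  refine congrArg sInf (Set.ext fun τ => and_congr_right fun _ => ?_)
  exact ⟨fun h => hf.isEmbedding.isTightWith h, isTightWith_of_isOpenEmbedding hcov⟩

end CardinalInvariants

/-! ### The circle and its powers -/

/-- The class of `1 / (2n)` in `ℝ/ℤ`. -/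
noncomputable def halfInv (n : ℤ) : UnitAddCircle := (((2 : ℝ) * n)⁻¹ : ℝ)

/-- Together with `tendsto_halfInv`, this supplies arbitrarily small points of the circle that
multiplication by a large `n` sends to the point farthest from `0`. -/
theorem norm_zsmul_halfInv {n : ℤ} (hn : n ≠ 0) : ‖n • halfInv n‖ = 1 / 2 := by
  have h : n • halfInv n = (((1 : ℝ) / 2 : ℝ) : UnitAddCircle) := by
    have hn' : (n : ℝ) ≠ 0 := by exact_mod_cast hn
    rw [halfInv, ← AddCircle.coe_zsmul]
    congr 1
    rw [zsmul_eq_mul]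
    field_simp
  rw [h, AddCircle.norm_half_period_eq, abs_one]

theorem tendsto_halfInv : Filter.Tendsto halfInv Filter.cofinite (𝓝 0) := by
  have h : Filter.Tendsto (fun n : ℤ => ((2 : ℝ) * n)⁻¹) Filter.cofinite (𝓝 0) := by
    have h1 := Filter.tendsto_inv₀_cobounded (α := ℝ)
    rw [Metric.cobounded_eq_cocompact] at h1
    have h2 := (h1.comp Int.tendsto_coe_cofinite).const_mul (2⁻¹ : ℝ)
    simpa [Function.comp_def, mul_inv, mul_comm] using h2
  have h3 := ((AddCircle.continuous_mk' (1 : ℝ)).tendsto 0).comp h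
  rw [map_zero] at h3
  exact h3

theorem mk_unitAddCircle : #UnitAddCircle = 𝔠 := by
  rw [(AddCircle.equivIco (1 : ℝ) 0).cardinal_eq]
  exact mk_Ico_real (by norm_num)

section DenseSubgroup

variable {ι : Type u} {H : AddSubgroup (ι → UnitAddCircle)}

/-- A basic neighbourhood leaves the coordinates outside a finite set free, so one of them can be
set to `1/2`; density moves the resulting point into `H`. -/
theorem exists_finset_forall_notMem_exists_norm (hH : Dense (H : Set (ι → UnitAddCircle)))
    {U : Set H} (hU : U ∈ 𝓝 0) :
    ∃ F : Finset ι, ∀ i ∉ F, ∃ h ∈ U, 1 / 4 < ‖(h : ι → UnitAddCircle) i‖ := by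
  classical
  rw [nhds_subtype, Filter.mem_comap] at hU
  obtain ⟨V, hV, hVU⟩ := hU
  obtain ⟨V', hV'V, hV'o, hV'0⟩ := mem_nhds_iff.1 hV
  have hV'n := hV'o.mem_nhds hV'0
  rw [nhds_pi, Filter.mem_pi'] at hV'n
  obtain ⟨F, t, ht, hF⟩ := hV'n
  refine ⟨F, fun i hi => ?_⟩
  have hW : IsOpen (V' ∩ {x : ι → UnitAddCircle | 1 / 4 < ‖x i‖}) :=
    hV'o.inter (isOpen_lt continuous_const (by fun_prop))
  have hne : (V' ∩ {x : ι → UnitAddCircle | 1 / 4 < ‖x i‖}).Nonempty := by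
    refine ⟨Pi.single i (halfInv 1), hF fun j hj => ?_, ?_⟩
    · have hji : j ≠ i := fun hji => hi (hji ▸ hj)
      rw [Pi.single_eq_of_ne hji]
      exact mem_of_mem_nhds (ht j)
    · have := norm_zsmul_halfInv one_ne_zero
      rw [one_zsmul] at this
      simp only [Set.mem_ofPred_eq, Pi.single_eq_same, this]
      norm_num
  obtain ⟨h, hhH, hhW⟩ := hH.exists_mem_open hW hne
  exact ⟨⟨h, hhH⟩, hVU (hV'V hhW.1), hhW.2⟩

theorem mk_le_characterAt_zero (hH : Dense (H : Set (ι → UnitAddCircle))) (hι : ℵ₀ < #ι) :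
    #ι ≤ characterAt (0 : H) := by
  obtain ⟨B, hB, hcard⟩ := exists_hasBasis_mk_eq_characterAt (0 : H)
  rw [← hcard]
  choose F hF using fun b : B =>
    exists_finset_forall_notMem_exists_norm hH (hB.mem_of_mem b.2)
  -- A basic set inside `‖h i‖ < 1/4` controls the coordinate `i`. Thus `ι` is a union of `#B`
  -- finite sets.
  have hcov : (Set.univ : Set ι) ⊆ ⋃ b : B, (F b : Set ι) := by
    intro i _
    have hU : {h : H | ‖(h : ι → UnitAddCircle) i‖ < 1 / 4} ∈ 𝓝 (0 : H) := by
      refine (isOpen_lt ?_ continuous_const).mem_nhds (by simp)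
      exact ((continuous_apply i).comp continuous_subtype_val).norm
    obtain ⟨b, hb, hbU⟩ := hB.mem_iff.1 hU
    refine Set.mem_iUnion.2 ⟨⟨b, hb⟩, ?_⟩
    by_contra hi
    obtain ⟨h, hhb, hh⟩ := hF ⟨b, hb⟩ i hi
    exact lt_asymm hh (hbU hhb)
  have h1 : #ι ≤ max #B ℵ₀ := by
    rw [← mk_univ]
    refine (mk_le_mk_of_subset hcov).trans ((mk_iUnion_le _).trans ?_)
    refine mul_le_of_le (le_max_right _ _) (le_max_left _ _) (ciSup_le' fun b => ?_)
    exact (F b).countable_toSet.le_aleph0.trans (le_max_right _ _)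
  rcases le_max_iff.1 h1 with h | h
  · exact h
  · exact absurd h hι.not_ge

end DenseSubgroup

open scoped commutatorElement

namespace Heisenberg

variable {ι : Type u}

/-! ### Topology of the Heisenberg group -/

/-- The discrete topology on the character group `ℤ^(ι)`. -/
abbrev discreteFinsupp (ι : Type u) : TopologicalSpace (ι →₀ ℤ) := ⊥

attribute [local instance] discreteFinsupp

instance : DiscreteTopology (ι →₀ ℤ) := ⟨rfl⟩

theorem isInducing_coords :
    IsInducing (fun u : Heisenberg ι =>
      ((u.a, u.x, u.f) : UnitAddCircle × (ι → UnitAddCircle) × (ι →₀ ℤ))) :=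
  ⟨rfl⟩

theorem continuous_iff {X : Type*} [TopologicalSpace X] {g : X → Heisenberg ι} :
    Continuous g ↔ Continuous (fun y => (g y).a) ∧ Continuous (fun y => (g y).x) ∧
      Continuous (fun y => (g y).f) := by
  rw [isInducing_coords.continuous_iff]
  simp only [Function.comp_def, continuous_prodMk]

theorem continuous_a : Continuous (fun u : Heisenberg ι => u.a) :=
  (continuous_iff.1 continuous_id).1

theorem continuous_x : Continuous (fun u : Heisenberg ι => u.x) :=
  (continuous_iff.1 continuous_id).2.1

theorem continuous_f : Continuous (fun u : Heisenberg ι => u.f) :=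
  (continuous_iff.1 continuous_id).2.2

theorem continuous_pairing_right (f : ι →₀ ℤ) : Continuous (pairing f) := by
  unfold pairing Finsupp.sum
  fun_prop

theorem continuous_pairing {X : Type*} [TopologicalSpace X] {f : X → ι →₀ ℤ}
    {x : X → ι → UnitAddCircle} (hf : Continuous f) (hx : Continuous x) :
    Continuous (fun y => pairing (f y) (x y)) :=
  (continuous_prod_of_discrete_left (f := fun p : (ι →₀ ℤ) × (ι → UnitAddCircle) =>
    pairing p.1 p.2).2 continuous_pairing_right).comp (hf.prodMk hx)

instance : IsTopologicalGroup (Heisenberg ι) where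
  continuous_mul := by
    have hau := continuous_a.comp (continuous_fst (X := Heisenberg ι) (Y := Heisenberg ι))
    have hav := continuous_a.comp (continuous_snd (X := Heisenberg ι) (Y := Heisenberg ι))
    have hxu := continuous_x.comp (continuous_fst (X := Heisenberg ι) (Y := Heisenberg ι))
    have hxv := continuous_x.comp (continuous_snd (X := Heisenberg ι) (Y := Heisenberg ι))
    have hfu := continuous_f.comp (continuous_fst (X := Heisenberg ι) (Y := Heisenberg ι))
    have hfv := continuous_f.comp (continuous_snd (X := Heisenberg ι) (Y := Heisenberg ι))
    exact continuous_iff.2 ⟨(hau.add hav).add (continuous_pairing hfu hxv), hxu.add hxv,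
      continuous_of_discreteTopology (f := fun p : (ι →₀ ℤ) × (ι →₀ ℤ) => p.1 + p.2)
        |>.comp (hfu.prodMk hfv)⟩
  continuous_inv :=
    continuous_iff.2 ⟨continuous_a.neg.add (continuous_pairing continuous_f continuous_x),
      continuous_x.neg, (continuous_of_discreteTopology (f := fun f : ι →₀ ℤ => -f)).comp
        continuous_f⟩

instance : T2Space (Heisenberg ι) := by
  refine IsEmbedding.t2Space (f := fun u : Heisenberg ι =>
      ((u.a, u.x, u.f) : UnitAddCircle × (ι → UnitAddCircle) × (ι →₀ ℤ)))
      ⟨isInducing_coords, fun u v h => ?_⟩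
  simp only [Prod.mk.injEq] at h
  exact Heisenberg.ext h.1 h.2.1 h.2.2

theorem tendsto_one_iff {α : Type*} {l : Filter α} {g : α → Heisenberg ι} :
    Filter.Tendsto g l (𝓝 1) ↔ Filter.Tendsto (fun y => (g y).a) l (𝓝 0) ∧
      Filter.Tendsto (fun y => (g y).x) l (𝓝 0) ∧ ∀ᶠ y in l, (g y).f = 0 := by
  rw [isInducing_coords.tendsto_nhds_iff, nhds_prod_eq, nhds_prod_eq, Filter.tendsto_prod_iff',
    Filter.tendsto_prod_iff', nhds_discrete (ι →₀ ℤ), Filter.tendsto_pure]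
  rfl

/-! ### Characters -/

theorem pairing_single_left (i : ι) (n : ℤ) (x : ι → UnitAddCircle) :
    pairing (Finsupp.single i n) x = n • x i :=
  Finsupp.sum_single_index (zero_zsmul _)

theorem pairing_single_right [DecidableEq ι] (f : ι →₀ ℤ) (i : ι) (z : UnitAddCircle) :
    pairing f (Pi.single i z) = f i • z := by
  rw [pairing, Finsupp.sum, Finset.sum_eq_single i]
  · rw [Pi.single_eq_same]
  · intro j _ hj
    rw [Pi.single_eq_of_ne hj, smul_zero]
  · intro hi
    rw [Finsupp.notMem_support_iff.1 hi, zero_zsmul]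

theorem pairing_zero_right (f : ι →₀ ℤ) : pairing f 0 = 0 := by
  simp [pairing]

theorem exists_pairing_ne_zero {H : AddSubgroup (ι → UnitAddCircle)}
    (hH : Dense (H : Set (ι → UnitAddCircle))) {f : ι →₀ ℤ} (hf : f ≠ 0) :
    ∃ h ∈ H, pairing f h ≠ 0 := by
  classical
  by_contra! hcon
  obtain ⟨i, hi⟩ := Finsupp.ne_iff.1 hf
  have h0 := congrFun ((continuous_pairing_right f).ext_on hH continuous_const
    (g := fun _ => 0) hcon) (Pi.single i (halfInv (f i)))
  have h1 := norm_zsmul_halfInv hi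
  rw [pairing_single_right] at h0
  rw [h0, norm_zero] at h1
  norm_num at h1

/-- A set of characters that is uniformly small on a neighbourhood of zero is finite. -/
theorem finite_of_norm_pairing_le {H : AddSubgroup (ι → UnitAddCircle)}
    (hH : Dense (H : Set (ι → UnitAddCircle))) {S : Set (ι →₀ ℤ)} {U : Set H} (hU : U ∈ 𝓝 0)
    (hS : ∀ f ∈ S, ∀ h ∈ U, ‖pairing f (h : ι → UnitAddCircle)‖ ≤ 1 / 4) : S.Finite := by
  classical
  rw [nhds_subtype, Filter.mem_comap] at hU
  obtain ⟨V, hV, hVU⟩ := hU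
  obtain ⟨V', hV'V, hV'o, hV'0⟩ := mem_nhds_iff.1 hV
  have hV'n := hV'o.mem_nhds hV'0
  rw [nhds_pi, Filter.mem_pi'] at hV'n
  obtain ⟨F, t, ht, hF⟩ := hV'n
  -- Coordinate vectors need not lie in `H`, so the bound is first extended by density to an open
  -- set of the full power.
  have hSV : ∀ f ∈ S, ∀ x ∈ V', ‖pairing f x‖ ≤ 1 / 4 := by
    intro f hf x hx
    have hcl : IsClosed {x : ι → UnitAddCircle | ‖pairing f x‖ ≤ 1 / 4} :=
      isClosed_le (continuous_pairing_right f).norm continuous_const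
    refine closure_minimal ?_ hcl (hH.open_subset_closure_inter hV'o hx)
    rintro y ⟨hyV, hyH⟩
    exact hS f hf ⟨y, hyH⟩ (hVU (hV'V hyV))
  have hfin : ∀ i, {n : ℤ | halfInv n ∉ t i}.Finite := fun i =>
    tendsto_halfInv.eventually (ht i)
  -- Supports lie in `F`, and each coefficient has finitely many possible values: otherwise a
  -- coordinate vector with entry `halfInv (f i)` would lie in `V'`, where `f` takes a value of norm
  -- `1/2`.
  refine (F.finsupp fun i => insert 0 (hfin i).toFinset).finite_toSet.subset fun f hf => ?_
  have key : ∀ i, f i ≠ 0 → i ∈ F ∧ halfInv (f i) ∉ t i := by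
    intro i hi
    by_contra hcon
    have hmem : Pi.single i (halfInv (f i)) ∈ V' := by
      refine hF fun j hj => ?_
      rcases eq_or_ne j i with rfl | hji
      · rw [Pi.single_eq_same]
        exact not_not.1 fun hn => hcon ⟨hj, hn⟩
      · rw [Pi.single_eq_of_ne hji]
        exact mem_of_mem_nhds (ht j)
    have h1 := hSV f hf _ hmem
    rw [pairing_single_right, norm_zsmul_halfInv hi] at h1
    norm_num at h1
  rw [Finset.mem_coe, Finset.mem_finsupp_iff]
  refine ⟨fun i hi => (key i (Finsupp.mem_support_iff.1 hi)).1, fun i _ => ?_⟩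
  rcases eq_or_ne (f i) 0 with h | h
  · exact Finset.mem_insert.2 (Or.inl h)
  · exact Finset.mem_insert_of_mem ((hfin i).mem_toFinset.2 (key i h).2)

/-! ### Elements of the subgroup over `H` -/

section SubgroupOver

variable {H : AddSubgroup (ι → UnitAddCircle)}

/-- The element `(a, h, f)` of `G_H`. -/
noncomputable def mkOver (H : AddSubgroup (ι → UnitAddCircle)) (a : UnitAddCircle) (h : H)
    (f : ι →₀ ℤ) : subgroupOver H :=
  ⟨⟨a, h, f⟩, h.2⟩

theorem mkOver_mul (a b : UnitAddCircle) (h k : H) (f g : ι →₀ ℤ) :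
    mkOver H a h f * mkOver H b k g =
      mkOver H (a + b + pairing f (k : ι → UnitAddCircle)) (h + k) (f + g) := rfl

theorem mkOver_zero : mkOver H 0 0 0 = 1 := rfl

theorem mkOver_coords (u : subgroupOver H) : mkOver H u.1.a ⟨u.1.x, u.2⟩ u.1.f = u := rfl

theorem commutatorElement_mkOver (a b : UnitAddCircle) (h k : H) (f g : ι →₀ ℤ) :
    ⁅mkOver H a h f, mkOver H b k g⁆ =
      mkOver H (pairing f (k : ι → UnitAddCircle) - pairing g (h : ι → UnitAddCircle)) 0 0 := by
  rw [commutatorElement_def, mul_inv_eq_iff_eq_mul, mul_inv_eq_iff_eq_mul, mul_assoc]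
  simp only [mkOver_mul, pairing_zero_left, zero_add, add_comm k h, add_comm g f]
  congr 1
  abel

theorem continuous_mkOver {X : Type*} [TopologicalSpace X] {a : X → UnitAddCircle} {h : X → H}
    {f : X → ι →₀ ℤ} (ha : Continuous a) (hh : Continuous h) (hf : Continuous f) :
    Continuous fun y => mkOver H (a y) (h y) (f y) :=
  (continuous_iff.2 ⟨ha, continuous_subtype_val.comp hh, hf⟩).subtype_mk _

theorem tendsto_subgroupOver_one_iff {α : Type*} {l : Filter α} {g : α → subgroupOver H} :
    Filter.Tendsto g l (𝓝 1) ↔ Filter.Tendsto (fun y => (g y).1.a) l (𝓝 0) ∧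
      Filter.Tendsto (fun y => (g y).1.x) l (𝓝 0) ∧ ∀ᶠ y in l, (g y).1.f = 0 := by
  rw [tendsto_subtype_rng]
  exact tendsto_one_iff

/-! ### Minimality -/

/-- A continuous injection from a compact space to a Hausdorff space is a closed embedding. Here `K`
plays the role of `G_H` with a coarser topology. -/
theorem isClosedEmbedding_centre {K : Type*} [Group K] [TopologicalSpace K] [T2Space K]
    {e : subgroupOver H ≃* K} (he : Continuous e) :
    IsClosedEmbedding fun a : UnitAddCircle => e (mkOver H a 0 0) := by
  refine Continuous.isClosedEmbedding
    (he.comp (continuous_mkOver continuous_id continuous_const continuous_const)) fun a b h => ?_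
  exact congrArg (fun u : subgroupOver H => u.1.a) (e.injective h)

section Minimal

variable {K : Type*} [Group K] [TopologicalSpace K] [IsTopologicalGroup K] [T2Space K]
  {e : subgroupOver H ≃* K}

/-- The commutator pairing is continuous for every coarser Hausdorff group topology. -/
theorem continuous_commutatorPairing (he : Continuous e) :
    Continuous fun p : K × K => pairing (e.symm p.1).1.f (e.symm p.2).1.x -
      pairing (e.symm p.2).1.f (e.symm p.1).1.x := by
  -- Continuity may be tested after embedding the circle in `K`, where the map becomes the
  -- commutator.
  rw [(isClosedEmbedding_centre he).isInducing.continuous_iff]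
  have h : (fun a : UnitAddCircle => e (mkOver H a 0 0)) ∘
      (fun p : K × K => pairing (e.symm p.1).1.f (e.symm p.2).1.x -
        pairing (e.symm p.2).1.f (e.symm p.1).1.x) = fun p : K × K => ⁅p.1, p.2⁆ := by
    funext p
    have hc := commutatorElement_mkOver (e.symm p.1).1.a (e.symm p.2).1.a
      ⟨(e.symm p.1).1.x, (e.symm p.1).2⟩ ⟨(e.symm p.2).1.x, (e.symm p.2).2⟩
      (e.symm p.1).1.f (e.symm p.2).1.f
    simp only [mkOver_coords] at hc
    simp only [Function.comp_apply]
    rw [← hc, map_commutatorElement, e.apply_symm_apply, e.apply_symm_apply]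
  rw [h]
  simp only [commutatorElement_def]
  fun_prop

/-- The commutator with the `i`-th unit character reads off the coordinate `x i`. -/
theorem continuous_x_symm (he : Continuous e) : Continuous fun k : K => (e.symm k).1.x := by
  refine continuous_pi fun i => ?_
  have h := (continuous_commutatorPairing he).comp
    (Continuous.prodMk_right (e (mkOver H 0 0 (Finsupp.single i 1))))
  refine h.congr fun k => ?_
  simp only [Function.comp_apply, e.symm_apply_apply]
  simp [mkOver, pairing_single_left, pairing_zero_right]

theorem continuous_pairing_f_symm (he : Continuous e) (h : H) :
    Continuous fun k : K => pairing (e.symm k).1.f (h : ι → UnitAddCircle) := by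
  have h := (continuous_commutatorPairing he).comp
    (Continuous.prodMk_left (e (mkOver H 0 h 0)))
  refine h.congr fun k => ?_
  simp only [Function.comp_apply, e.symm_apply_apply]
  simp [mkOver, pairing_zero_left]

theorem eventually_f_symm_eq_zero (hH : Dense (H : Set (ι → UnitAddCircle)))
    (he : Continuous e) : ∀ᶠ k : K in 𝓝 1, (e.symm k).1.f = 0 := by
  have hfin : ∃ V ∈ 𝓝 (1 : K), ((fun k : K => (e.symm k).1.f) '' V).Finite := by
    have hsmall : ∀ᶠ p : K × K in 𝓝 (1, 1), ‖pairing (e.symm p.1).1.f (e.symm p.2).1.x -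
        pairing (e.symm p.2).1.f (e.symm p.1).1.x‖ < 1 / 4 := by
      refine (isOpen_lt (continuous_commutatorPairing he).norm continuous_const).mem_nhds ?_
      simp [map_one, one_def, pairing_zero_left]
    rw [nhds_prod_eq, Filter.eventually_iff, Filter.mem_prod_same_iff] at hsmall
    obtain ⟨V, hV, hsmall⟩ := hsmall
    -- Pairing `k ∈ V` with elements `(0,h,0)` that also lie in `V` bounds the character of `k`
    -- uniformly in `h`.
    refine ⟨V, hV, finite_of_norm_pairing_le hH
      (U := {h : H | e (mkOver H 0 h 0) ∈ V}) ?_ ?_⟩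
    · have hc : Continuous fun h : H => e (mkOver H 0 h 0) :=
        he.comp (continuous_mkOver continuous_const continuous_id continuous_const)
      refine hc.continuousAt.preimage_mem_nhds ?_
      rwa [mkOver_zero, map_one]
    · rintro _ ⟨k, hk, rfl⟩ h hh
      have h1 := @hsmall (k, _) ⟨hk, hh⟩
      simp only [Set.mem_ofPred_eq, e.symm_apply_apply] at h1
      simpa [mkOver, pairing_zero_left] using h1.le
  obtain ⟨V, hV, hfin⟩ := hfin
  -- Each of the finitely many nonzero characters is nonzero at some `h ∈ H`, while evaluation at
  -- `h` is continuous and vanishes at `1`.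
  have hne : ∀ᶠ k : K in 𝓝 1, ∀ f ∈ ((fun k : K => (e.symm k).1.f) '' V) \ {0},
      (e.symm k).1.f ≠ f := by
    rw [Filter.eventually_all_finite hfin.sdiff]
    rintro f ⟨-, hf⟩
    obtain ⟨h, hh, hfh⟩ := exists_pairing_ne_zero hH hf
    have hev := (continuous_pairing_f_symm he ⟨h, hh⟩).continuousAt (x := 1)
      |>.eventually_ne (y := pairing f h) (by
        rw [map_one]
        exact fun h0 => hfh (h0.symm.trans (pairing_zero_left h)))
    filter_upwards [hev] with k hk hkf
    exact hk (by rw [hkf])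
  filter_upwards [hV, hne] with k hkV hk
  by_contra h0
  exact hk _ ⟨⟨k, hkV, rfl⟩, h0⟩ rfl

theorem tendsto_a_symm (hH : Dense (H : Set (ι → UnitAddCircle))) (he : Continuous e) :
    Filter.Tendsto (fun k : K => (e.symm k).1.a) (𝓝 1) (𝓝 0) := by
  intro W hW
  rw [(isClosedEmbedding_centre he).isInducing.nhds_eq_comap, Filter.mem_comap] at hW
  obtain ⟨W', hW', hWW'⟩ := hW
  rw [mkOver_zero, map_one] at hW'
  obtain ⟨V, hV, hVW⟩ := exists_nhds_split_inv hW'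
  have hs : Filter.Tendsto (fun k : K => e (mkOver H 0 ⟨(e.symm k).1.x, (e.symm k).2⟩ 0))
      (𝓝 1) (𝓝 1) := by
    have hc : Continuous fun k : K => e (mkOver H 0 ⟨(e.symm k).1.x, (e.symm k).2⟩ 0) :=
      he.comp (continuous_mkOver continuous_const ((continuous_x_symm he).subtype_mk _)
        continuous_const)
    have h1 := hc.tendsto 1
    have h2 : e (mkOver H 0 ⟨(e.symm 1).1.x, (e.symm 1).2⟩ 0) = 1 := by
      simp only [map_one]
      exact map_one e
    rwa [h2] at h1
  rw [Filter.mem_map]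
  filter_upwards [hV, hs hV, eventually_f_symm_eq_zero hH he] with k hk hsk hf
  refine hWW' ?_
  have h := hVW k hk _ hsk
  -- Once `f = 0`, the element is `(a,0,0)·(0,x,0)`, so its central factor is a quotient of two
  -- elements near `1`.
  have hdecomp : e (mkOver H (e.symm k).1.a 0 0) =
      k / e (mkOver H 0 ⟨(e.symm k).1.x, (e.symm k).2⟩ 0) := by
    rw [eq_div_iff_mul_eq', ← map_mul, mkOver_mul, ← e.eq_symm_apply]
    conv_rhs => rw [← mkOver_coords (e.symm k), hf]
    simp [pairing_zero_left]
  rw [← hdecomp] at h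
  exact h

theorem continuous_symm_of_dense (hH : Dense (H : Set (ι → UnitAddCircle)))
    (he : Continuous e) : Continuous e.symm := by
  refine continuous_of_continuousAt_one e.symm ?_
  rw [ContinuousAt, map_one, tendsto_subgroupOver_one_iff]
  refine ⟨tendsto_a_symm hH he, ?_, eventually_f_symm_eq_zero hH he⟩
  have h := (continuous_x_symm he).tendsto 1
  rwa [map_one] at h

theorem isMinimalGroup_subgroupOver (hH : Dense (H : Set (ι → UnitAddCircle))) :
    IsMinimalGroup (subgroupOver H) where
  isTopologicalGroup := inferInstance
  t2Space := inferInstance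
  eq_of_coarser t' ht' ht2 hle := by
    refine le_antisymm ?_ hle
    -- The identity, viewed as a map onto the group with topology `t'`, has a continuous inverse.
    have h := @continuous_symm_of_dense ι H (subgroupOver H) _ t' ht' ht2
      (MulEquiv.refl _) hH (continuous_id_iff_le.2 hle)
    exact continuous_id_iff_le.1 h

end Minimal

/-! ### Nilpotency -/

/-- The projection of `G_H` onto `H × ℤ^(ι)`. -/
noncomputable def projHom (H : AddSubgroup (ι → UnitAddCircle)) :
    subgroupOver H →* Multiplicative (H × (ι →₀ ℤ)) where
  toFun u := Multiplicative.ofAdd (⟨u.1.x, u.2⟩, u.1.f)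
  map_one' := rfl
  map_mul' _ _ := rfl

theorem ker_projHom_le_center : (projHom H).ker ≤ Subgroup.center (subgroupOver H) := by
  intro u hu
  have hu' : ((⟨u.1.x, u.2⟩, u.1.f) : H × (ι →₀ ℤ)) = 0 := hu
  obtain ⟨hx, hf⟩ := Prod.mk.inj hu'
  rw [Subgroup.mem_center_iff]
  intro v
  rw [← mkOver_coords u, ← mkOver_coords v, hx, hf, mkOver_mul, mkOver_mul]
  simp [pairing_zero_left, pairing_zero_right, add_comm]

theorem isNilpotent_subgroupOver : Group.IsNilpotent (subgroupOver H) :=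
  Subgroup.isNilpotent_of_ker_le_center (projHom H) ker_projHom_le_center

theorem nilpotencyClass_subgroupOver [Nonempty ι] (hH : Dense (H : Set (ι → UnitAddCircle))) :
    Group.nilpotencyClass (subgroupOver H) = 2 := by
  have := isNilpotent_subgroupOver (H := H)
  refine le_antisymm ?_ ?_
  · exact (Group.nilpotencyClass_le_of_ker_le_center (projHom H) ker_projHom_le_center).trans (Nat.succ_le_succ CommGroup.nilpotencyClass_le_one)
  · by_contra! hlt
    have hcomm := Group.IsNilpotent.nilpotencyClass_le_one_iff.1 (Nat.le_of_lt_succ hlt)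
    obtain ⟨i⟩ := ‹Nonempty ι›
    obtain ⟨h, hh, hne⟩ := exists_pairing_ne_zero hH
      (Finsupp.single_ne_zero.2 one_ne_zero : Finsupp.single i (1 : ℤ) ≠ 0)
    have h1 := hcomm.is_comm.comm (mkOver H 0 0 (Finsupp.single i 1)) (mkOver H 0 ⟨h, hh⟩ 0)
    rw [mkOver_mul, mkOver_mul] at h1
    have h2 := congrArg (fun u : subgroupOver H => u.1.a) h1
    exact hne (by simpa [mkOver, pairing_zero_left] using h2)

/-! ### The open subgroup `𝕋 × H` -/

/-- The projection of `G_H` onto `ℤ^(ι)`. -/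
noncomputable def charHom (H : AddSubgroup (ι → UnitAddCircle)) :
    subgroupOver H →* Multiplicative (ι →₀ ℤ) where
  toFun u := Multiplicative.ofAdd u.1.f
  map_one' := rfl
  map_mul' _ _ := rfl

theorem mem_ker_charHom {u : subgroupOver H} : u ∈ (charHom H).ker ↔ u.1.f = 0 := Iff.rfl

theorem isOpen_ker_charHom : IsOpen ((charHom H).ker : Set (subgroupOver H)) :=
  (isOpen_discrete ({0} : Set (ι →₀ ℤ))).preimage (continuous_f.comp continuous_subtype_val)

/-- The kernel of the projection onto `ℤ^(ι)` is `H × 𝕋`. -/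
noncomputable def kerCharHomEquiv (H : AddSubgroup (ι → UnitAddCircle)) :
    (charHom H).ker ≃ₜ* Multiplicative (H × UnitAddCircle) where
  toFun u := Multiplicative.ofAdd (⟨u.1.1.x, u.1.2⟩, u.1.1.a)
  invFun p := ⟨mkOver H p.toAdd.2 p.toAdd.1 0, rfl⟩
  left_inv u := by
    refine Subtype.ext ?_
    conv_rhs => rw [← mkOver_coords u.1, mem_ker_charHom.1 u.2]
    rfl
  right_inv _ := rfl
  map_mul' u v := by
    refine congrArg Multiplicative.ofAdd (Prod.ext rfl ?_)
    change u.1.1.a + v.1.1.a + pairing u.1.1.f v.1.1.x = u.1.1.a + v.1.1.a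
    rw [mem_ker_charHom.1 u.2, pairing_zero_left, add_zero]
  continuous_toFun := by
    have hv : Continuous fun u : (charHom H).ker => u.1.1 :=
      continuous_subtype_val.comp continuous_subtype_val
    exact continuous_ofAdd.comp
      (((continuous_x.comp hv).subtype_mk _).prodMk (continuous_a.comp hv))
  continuous_invFun :=
    (continuous_mkOver (continuous_snd.comp continuous_toAdd)
      (continuous_fst.comp continuous_toAdd) continuous_const).subtype_mk _

theorem mk_quotient_ker_charHom [Infinite ι] : #(subgroupOver H ⧸ (charHom H).ker) = #ι := by
  have hsurj : Function.Surjective (charHom H) := fun f => ⟨mkOver H 0 0 f.toAdd, rfl⟩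
  rw [(QuotientGroup.quotientKerEquivOfSurjective _ hsurj).toEquiv.cardinal_eq,
    Multiplicative.toAdd.cardinal_eq, mk_finsupp_lift_of_infinite]
  simp

theorem tightness_subgroupOver :
    tightness (subgroupOver H) = tightness (H × UnitAddCircle) := by
  refine tightness_eq_of_isOpenEmbedding fun u => ?_
  refine ⟨fun p => u * mkOver H p.2 p.1 0, ?_, ⟨0, ?_⟩⟩
  · have h : IsOpenEmbedding fun p : H × UnitAddCircle =>
        (((kerCharHomEquiv H).symm (Multiplicative.ofAdd p) : (charHom H).ker) :
          subgroupOver H) :=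
      isOpen_ker_charHom.isOpenEmbedding_subtypeVal.comp
        ((kerCharHomEquiv H).symm.toHomeomorph.isOpenEmbedding.comp
          (Homeomorph.isOpenEmbedding ⟨Multiplicative.ofAdd, continuous_ofAdd, continuous_toAdd⟩))
    exact (Homeomorph.mulLeft u).isOpenEmbedding.comp h
  · exact mul_one u

/-! ### Cardinality, weight and character -/

theorem mk_subgroupOver [Infinite ι] : #(subgroupOver H) = 𝔠 * #ι * #H := by
  have e : subgroupOver H ≃ UnitAddCircle × (ι →₀ ℤ) × H :=
    { toFun := fun u => (u.1.a, u.1.f, ⟨u.1.x, u.2⟩)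
      invFun := fun p => mkOver H p.1 p.2.2 p.2.1
      left_inv := fun _ => rfl
      right_inv := fun _ => rfl }
  rw [e.cardinal_eq, mk_prod, mk_prod, mk_unitAddCircle, mk_finsupp_lift_of_infinite]
  simp [mul_assoc]

theorem weight_subgroupOver_le [Infinite ι] : weight (subgroupOver H) ≤ #ι := by
  classical
  -- The discrete coordinate is encoded by two-valued maps into the circle, so that all maps have
  -- the same second countable target.
  let g : Option ι ⊕ (ι →₀ ℤ) → subgroupOver H → UnitAddCircle := fun j u =>
    match j with
    | Sum.inl none => u.1.a
    | Sum.inl (some i) => u.1.x i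
    | Sum.inr f => if u.1.f = f then 0 else halfInv 1
  have hhalf : (0 : UnitAddCircle) ≠ halfInv 1 := by
    intro h
    have h1 := norm_zsmul_halfInv one_ne_zero
    rw [← h, smul_zero, norm_zero] at h1
    norm_num at h1
  refine weight_le_of_eq_iInf_induced g (le_antisymm ?_ ?_) (aleph0_le_mk ι) ?_
  · refine le_iInf fun j => continuous_iff_le_induced.1 ?_
    rcases j with (_ | i) | f
    · exact continuous_a.comp continuous_subtype_val
    · exact (continuous_apply i).comp (continuous_x.comp continuous_subtype_val)
    · exact (continuous_of_discreteTopology (f := fun f' : ι →₀ ℤ =>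
        if f' = f then (0 : UnitAddCircle) else halfInv 1)).comp
        (continuous_f.comp continuous_subtype_val)
  · refine continuous_id_iff_le.1 ?_
    let t : TopologicalSpace (subgroupOver H) :=
      ⨅ j, TopologicalSpace.induced (g j) inferInstance
    have hg : ∀ j, Continuous[t, _] (g j) := fun j =>
      continuous_iInf_dom (i := j) continuous_induced_dom
    refine continuous_induced_rng.2 (continuous_iff.2 ⟨hg (Sum.inl none),
      continuous_pi fun i => hg (Sum.inl (some i)), continuous_discrete_rng.2 fun f => ?_⟩)
    convert (isOpen_compl_singleton (x := halfInv 1)).preimage (hg (Sum.inr f)) using 1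
    ext u
    by_cases hu : u.1.f = f <;> simp [g, hu, hhalf]
  · simp [mk_finsupp_lift_of_infinite, mk_option]

theorem isInducing_mkOver : IsInducing fun h : H => mkOver H 0 h 0 := by
  refine IsInducing.of_comp (g := fun u : subgroupOver H => u.1.x)
    (continuous_mkOver continuous_const continuous_id continuous_const)
    (continuous_x.comp continuous_subtype_val) ?_
  exact IsInducing.subtypeVal

theorem mk_le_characterAt_one (hH : Dense (H : Set (ι → UnitAddCircle))) (hι : ℵ₀ < #ι) :
    #ι ≤ characterAt (1 : subgroupOver H) :=
  (mk_le_characterAt_zero hH hι).trans (isInducing_mkOver.characterAt_le 0)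

end SubgroupOver

end Heisenberg

theorem theorem6p6 (κ : Cardinal.{u}) (hκ : ℵ₀ < κ) (ι : Type u) (hι : #ι = κ)
    (H : AddSubgroup (ι → UnitAddCircle)) (hH : Dense (H : Set (ι → UnitAddCircle))) :
    IsMinimalGroup (Heisenberg.subgroupOver H) ∧
    Group.IsNilpotent (Heisenberg.subgroupOver H) ∧
    Group.nilpotencyClass (Heisenberg.subgroupOver H) = 2 ∧
    (∃ O : Subgroup (Heisenberg.subgroupOver H),
      IsOpen (O : Set (Heisenberg.subgroupOver H)) ∧
      #(Heisenberg.subgroupOver H ⧸ O) = κ ∧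
      Nonempty (O ≃ₜ* Multiplicative (H × UnitAddCircle))) ∧
    #(Heisenberg.subgroupOver H) = 𝔠 * κ * #H ∧
    tightness (Heisenberg.subgroupOver H) = tightness (H × UnitAddCircle) ∧
    weight (Heisenberg.subgroupOver H) = κ ∧
    character (Heisenberg.subgroupOver H) = κ ∧
    character H = κ := by
  subst hι
  have : Infinite ι := infinite_iff.2 hκ.le
  have hG := Heisenberg.mk_le_characterAt_one hH hκ
  have hw := Heisenberg.weight_subgroupOver_le (H := H)
  refine ⟨Heisenberg.isMinimalGroup_subgroupOver hH, Heisenberg.isNilpotent_subgroupOver,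
    Heisenberg.nilpotencyClass_subgroupOver hH,
    ⟨_, Heisenberg.isOpen_ker_charHom, Heisenberg.mk_quotient_ker_charHom,
      ⟨Heisenberg.kerCharHomEquiv H⟩⟩,
    Heisenberg.mk_subgroupOver, Heisenberg.tightness_subgroupOver,
    hw.antisymm (hG.trans (characterAt_le_weight _)),
    (character_le_weight.trans hw).antisymm (hG.trans (characterAt_le_character _)),
    -- The upper bound for `H` is inherited from `G_H`, in which `H` embeds.
    le_antisymm (max_le hκ.le (ciSup_le' fun h => ?_))
      ((mk_le_characterAt_zero hH hκ).trans (characterAt_le_character _))⟩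
  exact (Heisenberg.isInducing_mkOver.characterAt_le h).trans ((characterAt_le_weight _).trans hw)
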